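/- Let $\mathcal{L}_A$ be the language $\{0,S,+,\times,\le\}$ of first-order arithmetic (with equality), fix a natural Gödel numbering of $\mathcal{L}_A$-formulas, and write $\ulcorner\varphi\urcorner$ for the numeral of the Gödel number of $\varphi$. Let $T$ be a primitive recursively axiomatized consistent extension of Peano arithmetic $\mathsf{PA}$ in the language $\mathcal{L}_A$. A formula $\mathrm{Pr}_T(x)$ in one free variable is a *provability predicate* of $T$ if for every formula $\varphi$, $T\vdash\varphi$ if and only if $\mathsf{PA}\vdash\mathrm{Pr}_T(\ulcorner\varphi\urcorner)$. An *arithmetical interpretation* based on $\mathrm{Pr}_T(x)$ is a map $f$ from modal propositional formulas (built from propositional variables, $\bot,\neg,\wedge,\vee,\to,\Box$) to $\mathcal{L}_A$-sentences such that $f(\bot)$ is $0=1$, $f$ commutes with $\neg,\wedge,\vee,\to$, and $f(\Box A)$ is $\mathrm{Pr}_T(\ulcorner f(A)\urcorner)$. The *provability logic* $\mathsf{PL}(\mathrm{Pr}_T)$ is the set of all modal formulas $A$ such that $T\vdash f(A)$ for every arithmetical interpretation $f$ based on $\mathrm{Pr}_T(x)$. Let $\Box^0A$ be $A$ and $\Box^{k+1}A$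 be $\Box\Box^kA$. Let $\mathbf{N}^+\mathbf{A}_{m,n}$ be the modal logic whose axioms are all propositional tautologies in the modal language and all formulas $\Box^nA\to\Box^mA$, and whose rules are modus ponens (from $A$ and $A\to B$ infer $B$), necessitation (from $A$ infer $\Box A$), and the rule: from $\neg\Box A$ infer $\neg\Box\Box A$. Then for every $n\ge1$: 1. for every propositional variable $p$, there is no provability predicate $\mathrm{Pr}_T(x)$ of $T$ such that $\Box^np\to p\in\mathsf{PL}(\mathrm{Pr}_T)$; 2. there is no provability predicate $\mathrm{Pr}_T(x)$ of $T$ such that $\mathbf{N}^+\mathbf{A}_{0,n}\subseteq\mathsf{PL}(\mathrm{Pr}_T)$. -/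

import Mathlib

open FirstOrder FirstOrder.Language

namespace ProvLogic

/-! ### The language of first-order arithmetic -/

/-- The function symbols `0`, `S`, `+`, `×`. -/
inductive ArithFunc : ℕ → Type
  | zero : ArithFunc 0
  | succ : ArithFunc 1
  | add : ArithFunc 2
  | mul : ArithFunc 2

/-- The only relation symbol besides equality is `≤`. -/
inductive ArithRel : ℕ → Type
  | le : ArithRel 2

/-- The language of first-order arithmetic. -/
def arith : Language :=
  { Functions := ArithFunc
    Relations := ArithRel }

/-- Arithmetical terms whose variables are among `x₀, …, x_{n-1}`. -/
abbrev ATerm (n : ℕ) := arith.Term (Empty ⊕ Fin n)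

/-- Arithmetical formulas whose free variables are among `x₀, …, x_{n-1}`; in this representation
the quantifier in `φ.all : AFormula n`, for `φ : AFormula (n + 1)`, binds the variable `x_n`. -/
abbrev AFormula (n : ℕ) := arith.BoundedFormula Empty n

/-- Arithmetical sentences. -/
abbrev ASentence := AFormula 0

/-- The variable `x_i`. -/
def x {n : ℕ} (i : Fin n) : ATerm n := Term.var (Sum.inr i)

def zero {n : ℕ} : ATerm n := Term.func (L := arith) ArithFunc.zero ![]

def succ {n : ℕ} (t : ATerm n) : ATerm n := Term.func (L := arith) ArithFunc.succ ![t]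

def add {n : ℕ} (t s : ATerm n) : ATerm n := Term.func (L := arith) ArithFunc.add ![t, s]

def mul {n : ℕ} (t s : ATerm n) : ATerm n := Term.func (L := arith) ArithFunc.mul ![t, s]

def eq {n : ℕ} (t s : ATerm n) : AFormula n := BoundedFormula.equal t s

def le {n : ℕ} (t s : ATerm n) : AFormula n :=
  BoundedFormula.rel (L := arith) ArithRel.le ![t, s]

/-- The numeral `S ⋯ S 0` of a natural number. -/
def numeral {n : ℕ} : ℕ → ATerm n
  | 0 => zero
  | k + 1 => succ (numeral k)

/-! ### Substitution -/

/-- Simultaneous substitution of terms for variables in a term. -/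
def substT {n m : ℕ} (σ : Fin n → ATerm m) (t : ATerm n) : ATerm m :=
  t.subst (Sum.elim Empty.elim σ)

/-- A term, regarded as a term in one more variable. -/
def liftT {n : ℕ} (t : ATerm n) : ATerm (n + 1) := substT (fun i => x i.castSucc) t

/-- The substitution `σ`, followed by the term `t` for the last variable. -/
def snoc {n m : ℕ} (σ : Fin n → ATerm m) (t : ATerm m) : Fin (n + 1) → ATerm m :=
  Fin.snoc (α := fun _ => ATerm m) σ t

/-- Capture-avoiding simultaneous substitution of terms for the free variables of a formula. -/
def substF : {n : ℕ} → AFormula n → {m : ℕ} → (Fin n → ATerm m) → AFormula m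
  | _, .falsum, _, _ => .falsum
  | _, .equal t s, _, σ => .equal (substT σ t) (substT σ s)
  | _, .rel R ts, _, σ => .rel R fun i => substT σ (ts i)
  | _, .imp φ ψ, _, σ => .imp (substF φ σ) (substF ψ σ)
  | _, .all φ, m, σ => .all (substF φ (snoc (fun i => liftT (σ i)) (x (Fin.last m))))

/-- A formula, regarded as a formula in one more variable. -/
def liftF {n : ℕ} (φ : AFormula n) : AFormula (n + 1) := substF φ fun i => x i.castSucc

/-- `inst φ t` is the result of substituting `t` for the last variable of `φ`. -/
def inst {n : ℕ} (φ : AFormula (n + 1)) (t : ATerm n) : AFormula n := substF φ (snoc x t)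

/-! ### Provability: natural deduction for classical first-order logic with equality -/

/-- `Derives Γ φ`: the formula `φ` is derivable from the set of assumptions `Γ`. -/
inductive Derives : {n : ℕ} → Set (AFormula n) → AFormula n → Prop
  | hyp {n : ℕ} {Γ : Set (AFormula n)} {φ : AFormula n} : φ ∈ Γ → Derives Γ φ
  | impI {n : ℕ} {Γ : Set (AFormula n)} {φ ψ : AFormula n} :
      Derives (insert φ Γ) ψ → Derives Γ (φ.imp ψ)
  | impE {n : ℕ} {Γ : Set (AFormula n)} {φ ψ : AFormula n} :
      Derives Γ (φ.imp ψ) → Derives Γ φ → Derives Γ ψ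
  | raa {n : ℕ} {Γ : Set (AFormula n)} {φ : AFormula n} :
      Derives (insert φ.not Γ) ⊥ → Derives Γ φ
  | allI {n : ℕ} {Γ : Set (AFormula n)} {φ : AFormula (n + 1)} :
      Derives (liftF '' Γ) φ → Derives Γ φ.all
  | allE {n : ℕ} {Γ : Set (AFormula n)} {φ : AFormula (n + 1)} (t : ATerm n) :
      Derives Γ φ.all → Derives Γ (inst φ t)
  | eqRefl {n : ℕ} {Γ : Set (AFormula n)} (t : ATerm n) : Derives Γ (eq t t)
  | eqSubst {n : ℕ} {Γ : Set (AFormula n)} {t s : ATerm n} (φ : AFormula (n + 1)) :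
      Derives Γ (eq t s) → Derives Γ (inst φ t) → Derives Γ (inst φ s)

/-- `T ⊢ φ`, for a theory `T` (a set of sentences, the axioms) and a formula `φ`. As usual, a
formula with free variables is provable when its universal closure is. -/
def Proves (T : Set ASentence) {n : ℕ} (φ : AFormula n) : Prop := Derives T (φ.alls : ASentence)

def Consistent (T : Set ASentence) : Prop := ¬ Proves T (⊥ : ASentence)

/-! ### Peano arithmetic -/

/-- The axioms of Peano arithmetic. In the induction scheme, `x_n` is the induction variable of
`φ`, and `x₀, …, x_{n-1}` are parameters. -/
inductive PA : Set ASentence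
  | succ_ne_zero : PA (BoundedFormula.alls (n := 1) (eq (succ (x 0)) zero).not)
  | succ_inj : PA (BoundedFormula.alls (n := 2)
      ((eq (succ (x 0)) (succ (x 1))).imp (eq (x 0) (x 1))))
  | add_zero : PA (BoundedFormula.alls (n := 1) (eq (add (x 0) zero) (x 0)))
  | add_succ : PA (BoundedFormula.alls (n := 2)
      (eq (add (x 0) (succ (x 1))) (succ (add (x 0) (x 1)))))
  | mul_zero : PA (BoundedFormula.alls (n := 1) (eq (mul (x 0) zero) zero))
  | mul_succ : PA (BoundedFormula.alls (n := 2)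
      (eq (mul (x 0) (succ (x 1))) (add (mul (x 0) (x 1)) (x 0))))
  | le_iff : PA (BoundedFormula.alls (n := 2)
      ((le (x 0) (x 1)).iff (BoundedFormula.ex (eq (add (x 2) (x 0)) (x 1)))))
  | induction {n : ℕ} (φ : AFormula (n + 1)) : PA (BoundedFormula.alls
      ((inst φ zero).imp
        ((φ.imp (substF φ (snoc (fun i => x i.castSucc) (succ (x (Fin.last n)))))).all.imp
          φ.all)))

/-! ### Gödel numbering -/

/-- The numbers of the function symbols. -/
def funcNum : {k : ℕ} → ArithFunc k → ℕ
  | _, .zero => 0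
  | _, .succ => 1
  | _, .add => 2
  | _, .mul => 3

/-- The number of the relation symbol `≤`. -/
def relNum : {k : ℕ} → ArithRel k → ℕ
  | _, .le => 4

/-- The number of the variable `x_i`; the numbers `5, 6, 7, 8` stand for `=`, `⊥`, `→`, `∀`. -/
def varNum (i : ℕ) : ℕ := 9 + i

/-- A term as a finite sequence of symbols, in Polish notation. -/
def strT {n : ℕ} : ATerm n → List ℕ
  | .var (Sum.inr i) => [varNum i]
  | .func (l := k) f ts => funcNum f :: (List.finRange k).flatMap fun i => strT (ts i)

/-- A formula as a finite sequence of symbols, in Polish notation. -/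
def strF : {n : ℕ} → AFormula n → List ℕ
  | _, .falsum => [6]
  | _, .equal t s => 5 :: (strT t ++ strT s)
  | _, .rel (l := k) R ts => relNum R :: (List.finRange k).flatMap fun i => strT (ts i)
  | _, .imp φ ψ => 7 :: (strF φ ++ strF ψ)
  | n, .all φ => 8 :: varNum n :: strF φ

/-- The Gödel number of a formula: the number of its sequence of symbols, where the empty sequence
has number `0`, and a sequence with first symbol `a` and rest `l` has number
`Nat.pair a (number of l) + 1`. A proper subsequence of consecutive symbols always has a smaller
number than the whole sequence. -/
def godelNum {n : ℕ} (φ : AFormula n) : ℕ := Encodable.encode (strF φ)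

/-- The numeral `⌜φ⌝` of the Gödel number of `φ`. -/
def quote {n m : ℕ} (φ : AFormula n) : ATerm m := numeral (godelNum φ)

/-- The set `T` of axioms is primitive recursive. -/
def PrimrecAxioms (T : Set ASentence) : Prop :=
  PrimrecPred fun k : ℕ => ∃ φ ∈ T, godelNum φ = k

/-! ### Provability predicates -/

/-- The sentence `Pr(t)`, for a formula `Pr(x)` in one free variable and a closed term `t`. -/
def app (Pr : AFormula 1) (t : ATerm 0) : ASentence := substF Pr fun _ => t

/-- `Pr(x)` is a provability predicate of `T`: for every formula `φ`, `T ⊢ φ` if and only if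
`PA ⊢ Pr(⌜φ⌝)`. -/
def IsProvabilityPredicate (T : Set ASentence) (Pr : AFormula 1) : Prop :=
  ∀ (n : ℕ) (φ : AFormula n), Proves T φ ↔ Proves PA (app Pr (quote φ))

/-! ### Modal logic -/

/-- The formulas of modal propositional logic. -/
inductive MF : Type
  | var : ℕ → MF
  | bot : MF
  | neg : MF → MF
  | and : MF → MF → MF
  | or : MF → MF → MF
  | imp : MF → MF → MF
  | box : MF → MF

/-- `boxes k A` is `□^k A`. -/
def boxes : ℕ → MF → MF
  | 0, A => A
  | k + 1, A => .box (boxes k A)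

/-- `f` is an arithmetical interpretation based on `Pr(x)`. -/
structure IsInterpretation (Pr : AFormula 1) (f : MF → ASentence) : Prop where
  bot : f .bot = eq (numeral 0) (numeral 1)
  neg : ∀ A, f (.neg A) = (f A).not
  and : ∀ A B, f (.and A B) = f A ⊓ f B
  or : ∀ A B, f (.or A B) = f A ⊔ f B
  imp : ∀ A B, f (.imp A B) = (f A).imp (f B)
  box : ∀ A, f (.box A) = app Pr (quote (f A))

/-- The provability logic of `Pr(x)` (with respect to `T`). -/
def PL (T : Set ASentence) (Pr : AFormula 1) : Set MF :=
  {A | ∀ f : MF → ASentence, IsInterpretation Pr f → Proves T (f A)}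

/-- The truth value of a modal formula when the propositional variables and the formulas `□B` are
given arbitrary truth values by `v`. -/
def eval (v : MF → Prop) : MF → Prop
  | .var i => v (.var i)
  | .bot => False
  | .neg A => ¬ eval v A
  | .and A B => eval v A ∧ eval v B
  | .or A B => eval v A ∨ eval v B
  | .imp A B => eval v A → eval v B
  | .box A => v (.box A)

/-- Propositional tautologies in the modal language. -/
def IsTautology (A : MF) : Prop := ∀ v : MF → Prop, eval v A

/-- The logic `N⁺A_{m,n}`, as the set of its theorems: propositional tautologies, modus ponens and
necessitation (these give the pure logic of necessitation `N`), the axiom scheme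
`□^n A → □^m A`, and the rule that infers `¬□□A` from `¬□A`. -/
inductive NA (m n : ℕ) : Set MF
  | taut {A : MF} : IsTautology A → NA m n A
  | acc (A : MF) : NA m n ((boxes n A).imp (boxes m A))
  | mp {A B : MF} : NA m n (A.imp B) → NA m n A → NA m n B
  | nec {A : MF} : NA m n A → NA m n A.box
  | ros {A : MF} : NA m n A.box.neg → NA m n A.box.box.neg

end ProvLogic

namespace ProvLogic

/-! ### Substitution -/

section Substitution

variable {n m l : ℕ}

/-! Diagonalization refutes reflection for an iterated box. Take a sentence `G` that `PA` proves
equivalent to the negation of its own `n`-fold boxing. If `□^n p → p` were in the provability logic,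
interpreting `p` as `G` would give `T ⊢ □^n G → G`; since also `T ⊢ ¬G → □^n G`, it follows that `T
⊢ G`. The definition of a provability predicate, applied `n` times, then yields `T ⊢ □^n G`, whereas
`G` itself yields `T ⊢ ¬□^n G`. No derivability conditions are needed. The second claim follows
because `□^n p → p` is an axiom of the logic when `m = 0`.

The work lies in obtaining `G` (`exists_fixed_point`) purely syntactically. Decidable relations and
primitive recursive functions are represented in `PA` (`Rep.of_primrec`, through Gödel's β
function), and the diagonal map and `k ↦ ⌜Pr(k)⌝` are shown to be primitive recursive on Gödel
numbers. Propositional steps inside `PA` are delegated to `Derives.of_valuation`: a formula is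
derivable once every truth assignment respecting the connectives and the derivable formulas makes it
true. -/

@[simp] theorem substT_x (σ : Fin n → ATerm m) (i : Fin n) : substT σ (x i) = σ i := rfl

@[simp] theorem substT_zero (σ : Fin n → ATerm m) : substT σ zero = zero := by
  simp only [substT, zero, Term.subst]
  congr 1
  exact funext fun i => i.elim0

@[simp] theorem substT_succ (σ : Fin n → ATerm m) (t : ATerm n) :
    substT σ (succ t) = succ (substT σ t) := by
  simp only [substT, succ, Term.subst]
  congr 1
  exact funext fun i => by fin_cases i; rfl

@[simp] theorem substT_add (σ : Fin n → ATerm m) (t s : ATerm n) :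
    substT σ (add t s) = add (substT σ t) (substT σ s) := by
  simp only [substT, add, Term.subst]
  congr 1
  exact funext fun i => by fin_cases i <;> rfl

@[simp] theorem substT_mul (σ : Fin n → ATerm m) (t s : ATerm n) :
    substT σ (mul t s) = mul (substT σ t) (substT σ s) := by
  simp only [substT, mul, Term.subst]
  congr 1
  exact funext fun i => by fin_cases i <;> rfl

@[simp] theorem substT_numeral (σ : Fin n → ATerm m) (k : ℕ) :
    substT σ (numeral k) = numeral k := by
  induction k with
  | zero => exact substT_zero σ
  | succ k ih => rw [numeral, substT_succ, ih, numeral]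

theorem substT_substT (σ : Fin n → ATerm m) (τ : Fin m → ATerm l) (t : ATerm n) :
    substT τ (substT σ t) = substT (fun i => substT τ (σ i)) t := by
  induction t with
  | var i => rcases i with i | i; exacts [i.elim, rfl]
  | func f ts ih =>
    simp only [substT, Term.subst] at ih ⊢
    congr 1
    exact funext ih

@[simp] theorem substT_id (t : ATerm n) : substT x t = t := by
  induction t with
  | var i => rcases i with i | i; exacts [i.elim, rfl]
  | func f ts ih =>
    simp only [substT, Term.subst] at ih ⊢
    congr 1
    exact funext ih

@[simp] theorem snoc_castSucc (σ : Fin n → ATerm m) (t : ATerm m) (i : Fin n) :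
    snoc σ t i.castSucc = σ i := by simp [snoc]

@[simp] theorem snoc_last (σ : Fin n → ATerm m) (t : ATerm m) :
    snoc σ t (Fin.last n) = t := by simp [snoc]

@[simp] theorem liftT_x (i : Fin n) : liftT (x i) = x i.castSucc := rfl

@[simp] theorem liftT_zero : liftT (zero : ATerm n) = zero := substT_zero _

@[simp] theorem liftT_succ (t : ATerm n) : liftT (succ t) = succ (liftT t) := substT_succ _ _

@[simp] theorem liftT_add (t s : ATerm n) : liftT (add t s) = add (liftT t) (liftT s) :=
  substT_add _ _ _

@[simp] theorem liftT_numeral (k : ℕ) : liftT (numeral k : ATerm n) = numeral k :=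
  substT_numeral _ _

@[simp] theorem substT_snoc_liftT (σ : Fin n → ATerm m) (s : ATerm m) (t : ATerm n) :
    substT (snoc σ s) (liftT t) = substT σ t := by
  simp [liftT, substT_substT]

theorem liftT_substT (σ : Fin n → ATerm m) (t : ATerm n) :
    liftT (substT σ t) = substT (fun i => liftT (σ i)) t := substT_substT _ _ _

theorem substT_comp_snoc (σ : Fin n → ATerm m) (t : ATerm m) (τ : Fin m → ATerm l) :
    (fun i => substT τ (snoc σ t i)) = snoc (fun i => substT τ (σ i)) (substT τ t) := by
  funext i
  refine Fin.lastCases ?_ (fun i => ?_) i <;> simp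

theorem substF_substF {n : ℕ} (φ : AFormula n) : ∀ {m l : ℕ} (σ : Fin n → ATerm m)
    (τ : Fin m → ATerm l), substF (substF φ σ) τ = substF φ fun i => substT τ (σ i) := by
  induction φ with
  | falsum => intros; rfl
  | equal t s => intros; simp [substF, substT_substT]
  | rel R ts => intros; simp [substF, substT_substT]
  | imp φ ψ h₁ h₂ => intros; simp [substF, h₁, h₂]
  | all φ ih =>
    intro m l σ τ
    simp [substF, ih, substT_comp_snoc, liftT_substT]

theorem snoc_x : snoc (fun i => x i.castSucc) (x (Fin.last n)) = x := by
  funext i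
  refine Fin.lastCases ?_ (fun i => ?_) i <;> simp

@[simp] theorem substF_id (φ : AFormula n) : substF φ x = φ := by
  induction φ with
  | falsum => rfl
  | equal t s => simp [substF]
  | rel R ts => simp [substF]
  | imp φ ψ h₁ h₂ => simp [substF, h₁, h₂]
  | all φ ih => simp [substF, snoc_x, ih]

variable (σ : Fin n → ATerm m)

@[simp] theorem substF_eq (t s : ATerm n) : substF (eq t s) σ = eq (substT σ t) (substT σ s) := rfl

@[simp] theorem substF_le (t s : ATerm n) : substF (le t s) σ = le (substT σ t) (substT σ s) := by
  simp only [substF, le]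
  congr 1
  exact funext fun i => by fin_cases i <;> rfl

@[simp] theorem substF_imp (φ ψ : AFormula n) :
    substF (φ.imp ψ) σ = (substF φ σ).imp (substF ψ σ) := rfl

@[simp] theorem substF_not (φ : AFormula n) : substF φ.not σ = (substF φ σ).not := rfl

@[simp] theorem substF_inf (φ ψ : AFormula n) : substF (φ ⊓ ψ) σ = substF φ σ ⊓ substF ψ σ := rfl

@[simp] theorem substF_sup (φ ψ : AFormula n) : substF (φ ⊔ ψ) σ = substF φ σ ⊔ substF ψ σ := rfl

@[simp] theorem substF_iff (φ ψ : AFormula n) :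
    substF (φ.iff ψ) σ = (substF φ σ).iff (substF ψ σ) := rfl

@[simp] theorem substF_all (φ : AFormula (n + 1)) :
    substF φ.all σ = (substF φ (snoc (fun i => liftT (σ i)) (x (Fin.last m)))).all := rfl

@[simp] theorem substF_ex (φ : AFormula (n + 1)) :
    substF φ.ex σ = (substF φ (snoc (fun i => liftT (σ i)) (x (Fin.last m)))).ex := rfl

/-- With `inst_substF`, this reduces instantiating and substituting, in either order, to a single
simultaneous substitution. Hence the rules `allE` and `eqSubst` are stable under substitution. -/
theorem substF_inst (φ : AFormula (n + 1)) (t : ATerm n) :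
    substF (inst φ t) σ = substF φ (snoc σ (substT σ t)) := by
  simp [inst, substF_substF, substT_comp_snoc]

theorem inst_substF (φ : AFormula (n + 1)) (t : ATerm m) :
    inst (substF φ (snoc (fun i => liftT (σ i)) (x (Fin.last m)))) t = substF φ (snoc σ t) := by
  simp [inst, substF_substF, substT_comp_snoc]

theorem liftF_substF (φ : AFormula n) : liftF (substF φ σ) = substF φ fun i => liftT (σ i) :=
  substF_substF _ _ _

@[simp] theorem substF_snoc_liftF (φ : AFormula n) (t : ATerm m) :
    substF (liftF φ) (snoc σ t) = substF φ σ := by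
  simp [liftF, substF_substF]

@[simp] theorem liftF_eq (t s : ATerm n) : liftF (eq t s) = eq (liftT t) (liftT s) := rfl

@[simp] theorem liftF_le (t s : ATerm n) : liftF (le t s) = le (liftT t) (liftT s) :=
  substF_le _ _ _

@[simp] theorem liftF_imp (φ ψ : AFormula n) : liftF (φ.imp ψ) = (liftF φ).imp (liftF ψ) := rfl

@[simp] theorem inst_eq (t s : ATerm (n + 1)) (r : ATerm n) :
    inst (eq t s) r = eq (substT (snoc x r) t) (substT (snoc x r) s) := rfl

@[simp] theorem inst_le (t s : ATerm (n + 1)) (r : ATerm n) :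
    inst (le t s) r = le (substT (snoc x r) t) (substT (snoc x r) s) := substF_le _ _ _

end Substitution

/-! ### Derivability -/

namespace Derives

variable {n : ℕ} {Γ Δ : Set (AFormula n)} {φ ψ χ : AFormula n}

theorem mono (h : Derives Γ φ) : ∀ {Δ}, Γ ⊆ Δ → Derives Δ φ := by
  induction h with
  | hyp h => exact fun hs => hyp (hs h)
  | impI _ ih => exact fun hs => impI (ih (Set.insert_subset_insert hs))
  | impE _ _ ih₁ ih₂ => exact fun hs => impE (ih₁ hs) (ih₂ hs)
  | raa _ ih => exact fun hs => raa (ih (Set.insert_subset_insert hs))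
  | allI _ ih => exact fun hs => allI (ih (Set.image_mono hs))
  | allE t _ ih => exact fun hs => allE t (ih hs)
  | eqRefl t => exact fun _ => eqRefl t
  | eqSubst φ _ _ ih₁ ih₂ => exact fun hs => eqSubst φ (ih₁ hs) (ih₂ hs)

theorem subst (h : Derives Γ φ) : ∀ {m : ℕ} (σ : Fin n → ATerm m),
    Derives ((fun ψ => substF ψ σ) '' Γ) (substF φ σ) := by
  induction h with
  | hyp h => exact fun σ => hyp ⟨_, h, rfl⟩
  | impI _ ih =>
    intro m σ
    have := ih σ
    rw [Set.image_insert_eq] at this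
    exact impI this
  | impE _ _ ih₁ ih₂ => exact fun σ => impE (ih₁ σ) (ih₂ σ)
  | raa _ ih =>
    intro m σ
    have := ih σ
    rw [Set.image_insert_eq] at this
    exact raa this
  | allI _ ih =>
    intro m σ
    -- The induction hypothesis is used for the substitution extended under the binder; on lifted
    -- assumptions it agrees with substituting first and lifting afterwards.
    refine allI ((ih _).mono ?_)
    rintro _ ⟨_, ⟨ψ, hψ, rfl⟩, rfl⟩
    exact ⟨_, ⟨ψ, hψ, rfl⟩, by simp [liftF_substF]⟩
  | allE t _ ih =>
    intro m σ
    have := allE (substT σ t) (ih σ)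
    rwa [inst_substF, ← substF_inst] at this
  | eqRefl t => exact fun σ => eqRefl _
  | eqSubst φ _ _ ih₁ ih₂ =>
    intro m σ
    have h₂ := ih₂ σ
    rw [substF_inst, ← inst_substF] at h₂
    have := eqSubst _ (ih₁ σ) h₂
    rwa [inst_substF, ← substF_inst] at this

/-- Derivations are grafted onto the assumptions; under `allI` they must be lifted, which is a case
of `subst`. This is what carries theorems of `PA` over to `T`. -/
theorem cut (h : Derives Γ φ) : ∀ {Δ}, (∀ ψ ∈ Γ, Derives Δ ψ) → Derives Δ φ := by
  have aux : ∀ {k : ℕ} {Γ Δ : Set (AFormula k)} {χ : AFormula k}, (∀ ψ ∈ Γ, Derives Δ ψ) →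
      ∀ ψ ∈ insert χ Γ, Derives (insert χ Δ) ψ := by
    rintro k Γ Δ χ hs ψ (rfl | hψ)
    exacts [hyp (Set.mem_insert _ _), (hs ψ hψ).mono (Set.subset_insert _ _)]
  induction h with
  | hyp h => exact fun hs => hs _ h
  | impI _ ih => exact fun hs => impI (ih (aux hs))
  | impE _ _ ih₁ ih₂ => exact fun hs => impE (ih₁ hs) (ih₂ hs)
  | raa _ ih => exact fun hs => raa (ih (aux hs))
  | allI _ ih =>
    refine fun {Δ} hs => allI (ih ?_)
    rintro _ ⟨ψ, hψ, rfl⟩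
    exact (hs ψ hψ).subst _
  | allE t _ ih => exact fun hs => allE t (ih hs)
  | eqRefl t => exact fun _ => eqRefl t
  | eqSubst φ _ _ ih₁ ih₂ => exact fun hs => eqSubst φ (ih₁ hs) (ih₂ hs)

theorem weaken (h : Derives Γ φ) : Derives (insert ψ Γ) φ := h.mono (Set.subset_insert _ _)

theorem head : Derives (insert φ Γ) φ := hyp (Set.mem_insert _ _)

theorem exfalso (h : Derives Γ ⊥) : Derives Γ φ := raa h.weaken

/-- Peirce's law, with an arbitrary conclusion. -/
theorem peirce : Derives Γ (((φ.imp ψ).imp χ).imp ((φ.imp χ).imp χ)) := by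
  refine impI (impI (raa ?_))
  refine impE head (impE (ψ := χ) head.weaken.weaken (impI ?_))
  refine exfalso (impE head.weaken (impE head.weaken.weaken head))

/-- A truth-value assignment that respects implication and falsity and makes everything derivable
from `Γ` true. -/
structure IsValuation (Γ : Set (AFormula n)) (v : AFormula n → Prop) : Prop where
  bot : ¬ v ⊥
  imp : ∀ φ ψ, v (φ.imp ψ) ↔ (v φ → v ψ)
  of_derives : ∀ φ, Derives Γ φ → v φ

namespace IsValuation

variable {v : AFormula n → Prop}

theorem not (hv : IsValuation Γ v) (φ : AFormula n) : v φ.not ↔ ¬ v φ := by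
  rw [BoundedFormula.not, hv.imp]
  exact ⟨fun h h' => hv.bot (h h'), fun h h' => (h h').elim⟩

theorem inf (hv : IsValuation Γ v) (φ ψ : AFormula n) : v (φ ⊓ ψ) ↔ v φ ∧ v ψ := by
  change v (φ.imp ψ.not).not ↔ _
  rw [hv.not, hv.imp, hv.not]
  tauto

theorem sup (hv : IsValuation Γ v) (φ ψ : AFormula n) : v (φ ⊔ ψ) ↔ v φ ∨ v ψ := by
  change v (φ.not.imp ψ) ↔ _
  rw [hv.imp, hv.not]
  tauto

theorem iff (hv : IsValuation Γ v) (φ ψ : AFormula n) : v (φ.iff ψ) ↔ (v φ ↔ v ψ) := by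
  rw [BoundedFormula.iff, hv.inf, hv.imp, hv.imp]
  tauto

end IsValuation

/-- Completeness for propositional consequence. -/
theorem of_valuation (h : ∀ v, IsValuation Γ v → v φ) : Derives Γ φ := by
  by_contra hφ
  -- Lindenbaum's argument: Zorn gives a maximal set closed under modus ponens that contains the
  -- consequences of `Γ` and omits `φ`. Membership in it will be the valuation.
  let 𝒮 : Set (Set (AFormula n)) :=
    {S | (∀ a b, a.imp b ∈ S → a ∈ S → b ∈ S) ∧ {ψ | Derives Γ ψ} ⊆ S ∧ φ ∉ S}
  obtain ⟨S, -, hS⟩ := zorn_subset_nonempty 𝒮 (by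
    intro c hc hchain hne
    refine ⟨⋃₀ c, ⟨?_, ?_, ?_⟩, fun s hs => Set.subset_sUnion_of_mem hs⟩
    · rintro a b ⟨S₁, h₁, ha⟩ ⟨S₂, h₂, hb⟩
      rcases hchain.total h₁ h₂ with h | h
      · exact ⟨S₂, h₂, (hc h₂).1 a b (h ha) hb⟩
      · exact ⟨S₁, h₁, (hc h₁).1 a b ha (h hb)⟩
    · obtain ⟨S, hS⟩ := hne
      exact (hc hS).2.1.trans (Set.subset_sUnion_of_mem hS)
    · rintro ⟨S, hS, hφ⟩
      exact (hc hS).2.2 hφ) {ψ | Derives Γ ψ}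
    ⟨fun _ _ => impE, subset_rfl, hφ⟩
  obtain ⟨mp, sub, hφS⟩ := hS.prop
  have key : ∀ a ∉ S, a.imp φ ∈ S := by
    intro a ha
    by_contra hc
    -- If `a → φ` were missing from `S`, then `{b | a → b ∈ S}` would be an admissible extension of
    -- `S` containing `a`, against maximality.
    refine ha (hS.le_of_ge (y := {b | a.imp b ∈ S}) ⟨?_, ?_, hc⟩ ?_ (sub (impI head)))
    · exact fun b c hbc hb => mp _ _ (mp _ _ (sub (impI (impI (impI
        (impE (impE head.weaken.weaken head) (impE head.weaken head)))))) hbc) hb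
    · exact fun b hb => sub (impI (weaken hb))
    · exact fun b hb => mp _ _ (sub (impI (impI head.weaken))) hb
  refine hφS (h (· ∈ S) ⟨fun hb => hφS (mp _ _ (sub (impI (exfalso head))) hb),
    fun a b => ⟨mp a b, fun hab => ?_⟩, fun _ h => sub h⟩)
  by_contra hc
  by_cases ha : a ∈ S
  · exact hc (mp _ _ (sub (impI (impI head.weaken))) (hab ha))
  -- With `a` and `a → b` both outside `S`, both imply `φ` in `S`, and Peirce's law puts `φ` itself
  -- in `S`.
  · exact hφS (mp _ _ (mp _ _ (sub peirce) (key _ hc)) (key _ ha))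

end Derives

/-! ### Derivability of open formulas in Peano arithmetic -/

/-- The axioms of Peano arithmetic, as formulas in `n` variables. -/
def liftedPA (n : ℕ) : Set (AFormula n) := (fun φ : ASentence => substF φ Fin.elim0) '' PA

/-- `Pv φ`: the open formula `φ` is derivable in Peano arithmetic. -/
def Pv {n : ℕ} (φ : AFormula n) : Prop := Derives (liftedPA n) φ

/-- The axioms are sentences, so adding a variable does not change them; generalization over
derivations from `PA` therefore has no side condition. -/
theorem liftF_image_liftedPA (n : ℕ) : liftF '' liftedPA n = liftedPA (n + 1) := by
  rw [liftedPA, liftedPA, Set.image_image]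
  congr 1
  funext φ
  rw [liftF_substF]
  congr 1
  exact funext fun i => i.elim0

theorem liftedPA_zero : liftedPA 0 = PA := by
  have : (fun φ : ASentence => substF φ Fin.elim0) = id := by
    funext φ
    rw [Subsingleton.elim Fin.elim0 x, substF_id, id]
  rw [liftedPA, this, Set.image_id]

theorem pv_sentence {φ : ASentence} : Pv φ ↔ Derives PA φ := by rw [Pv, liftedPA_zero]

namespace Pv

variable {n m : ℕ} {φ ψ χ : AFormula n}

theorem mp (h : Pv (φ.imp ψ)) (h' : Pv φ) : Pv ψ := Derives.impE h h'

theorem subst (h : Pv φ) (σ : Fin n → ATerm m) : Pv (substF φ σ) := by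
  have := Derives.subst h σ
  rwa [liftedPA, Set.image_image, show (fun φ : ASentence => substF (substF φ Fin.elim0) σ) =
    fun φ => substF φ Fin.elim0 from funext fun φ => by
      rw [substF_substF]; congr 1; exact funext fun i => i.elim0] at this

theorem lift (h : Pv φ) : Pv (liftF φ) := h.subst _

theorem all {φ : AFormula (n + 1)} (h : Pv φ) : Pv φ.all :=
  Derives.allI (by rwa [liftF_image_liftedPA])

theorem of_all {φ : AFormula (n + 1)} (h : Pv φ.all) : Pv φ := by
  have := Derives.allE (x (Fin.last n)) h.lift
  rwa [inst_substF, snoc_x, substF_id] at this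

theorem of_alls : ∀ {n : ℕ} {φ : AFormula n}, Pv (φ.alls : ASentence) → Pv φ
  | 0, _, h => h
  | _ + 1, _, h => of_all (of_alls h)

theorem of_axiom {φ : AFormula n} (h : φ.alls ∈ PA) (σ : Fin n → ATerm m) : Pv (substF φ σ) :=
  (of_alls (pv_sentence.2 (.hyp h))).subst σ

theorem of_valuation (h : ∀ v, Derives.IsValuation (liftedPA n) v → v φ) : Pv φ :=
  Derives.of_valuation h

theorem trans (h : Pv (φ.imp ψ)) (h' : Pv (ψ.imp χ)) : Pv (φ.imp χ) :=
  of_valuation fun _ hv => (hv.imp _ _).2 fun h₁ =>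
    (hv.imp _ _).1 (hv.of_derives _ h') ((hv.imp _ _).1 (hv.of_derives _ h) h₁)

theorem const (h : Pv ψ) : Pv (φ.imp ψ) := Derives.impI h.weaken

theorem contra (h : Pv (φ.imp ψ)) : Pv (ψ.not.imp φ.not) :=
  of_valuation fun v hv => by
    have := hv.of_derives _ h
    simp only [hv.imp, hv.not] at this ⊢
    tauto

theorem imp_all {φ : AFormula n} {ψ : AFormula (n + 1)} (h : Pv ((liftF φ).imp ψ)) :
    Pv (φ.imp ψ.all) := by
  refine Derives.impI (Derives.allI ?_)
  rw [Set.image_insert_eq, liftF_image_liftedPA]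
  exact Derives.impE (Derives.weaken h) Derives.head

theorem all_imp {φ : AFormula (n + 1)} (t : ATerm n) : Pv (φ.all.imp (ProvLogic.inst φ t)) :=
  Derives.impI (Derives.allE t Derives.head)

theorem imp_ex {φ : AFormula (n + 1)} (t : ATerm n) : Pv ((ProvLogic.inst φ t).imp φ.ex) :=
  of_valuation fun v hv => by
    have h := hv.of_derives _ (all_imp (φ := φ.not) t)
    have e : ProvLogic.inst φ.not t = (ProvLogic.inst φ t).not := rfl
    rw [e, hv.imp, hv.not] at h
    rw [hv.imp, BoundedFormula.ex, hv.not]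
    tauto

theorem ex_imp {φ : AFormula (n + 1)} {ψ : AFormula n} (h : Pv (φ.imp (liftF ψ))) :
    Pv (φ.ex.imp ψ) := by
  have h₁ : Pv (ψ.not.imp φ.not.all) := imp_all h.contra
  refine of_valuation fun v hv => ?_
  have := hv.of_derives _ h₁
  rw [hv.imp, hv.not] at this
  rw [hv.imp, BoundedFormula.ex, hv.not]
  tauto

/-! ### Equality -/

theorem eq_refl (t : ATerm n) : Pv (eq t t) := Derives.eqRefl t

theorem eq_subst_inst (t s : ATerm n) (φ : AFormula (n + 1)) :
    Pv ((eq t s).imp ((ProvLogic.inst φ t).imp (ProvLogic.inst φ s))) :=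
  Derives.impI (Derives.impI (Derives.eqSubst φ Derives.head.weaken Derives.head))

theorem eq_subst (t s : ATerm m) (σ : Fin n → ATerm m) (φ : AFormula (n + 1)) :
    Pv ((eq t s).imp ((substF φ (snoc σ t)).imp (substF φ (snoc σ s)))) := by
  have := eq_subst_inst t s (substF φ (snoc (fun i => liftT (σ i)) (x (Fin.last m))))
  rwa [inst_substF, inst_substF] at this

theorem eq_congr (t s : ATerm n) (r : ATerm (n + 1)) :
    Pv ((eq t s).imp (eq (substT (snoc x t) r) (substT (snoc x s) r))) := by
  have := eq_subst_inst t s (eq (liftT (substT (snoc x t) r)) r)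
  simp only [inst_eq, substT_snoc_liftT, substT_id] at this
  refine of_valuation fun v hv => ?_
  have h₁ := hv.of_derives _ this
  have h₂ := hv.of_derives _ (eq_refl (substT (snoc x t) r))
  simp only [hv.imp] at h₁ ⊢
  tauto

theorem eq_symm (t s : ATerm n) : Pv ((eq t s).imp (eq s t)) := by
  have := eq_subst_inst t s (eq (x (Fin.last n)) (liftT t))
  simp only [inst_eq, substT_snoc_liftT, substT_id, substT_x, snoc_last] at this
  refine of_valuation fun v hv => ?_
  have h₁ := hv.of_derives _ this
  have h₂ := hv.of_derives _ (eq_refl t)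
  simp only [hv.imp] at h₁ ⊢
  tauto

theorem eq_trans (t s r : ATerm n) : Pv ((eq t s).imp ((eq s r).imp (eq t r))) := by
  have h := eq_subst_inst s r (eq (liftT t) (x (Fin.last n)))
  simp only [inst_eq, substT_snoc_liftT, substT_id, substT_x, snoc_last] at h
  refine of_valuation fun v hv => ?_
  have h₁ := hv.of_derives _ h
  simp only [hv.imp] at h₁ ⊢
  tauto

theorem succ_congr (t s : ATerm n) : Pv ((eq t s).imp (eq (succ t) (succ s))) := by
  simpa using eq_congr t s (succ (x (Fin.last n)))

theorem add_congr_left (r t s : ATerm n) : Pv ((eq t s).imp (eq (add t r) (add s r))) := by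
  simpa using eq_congr t s (add (x (Fin.last n)) (liftT r))

theorem le_congr_left (r t s : ATerm n) : Pv ((eq t s).imp ((le t r).imp (le s r))) := by
  simpa using eq_subst_inst t s (le (x (Fin.last n)) (liftT r))

theorem le_congr_right (r t s : ATerm n) : Pv ((eq t s).imp ((le r t).imp (le r s))) := by
  simpa using eq_subst_inst t s (le (liftT r) (x (Fin.last n)))

theorem symm {t s : ATerm n} (h : Pv (eq t s)) : Pv (eq s t) := (eq_symm t s).mp h

theorem etrans {t s r : ATerm n} (h : Pv (eq t s)) (h' : Pv (eq s r)) : Pv (eq t r) :=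
  ((eq_trans t s r).mp h).mp h'

/-! ### The axioms -/

theorem succ_ne_zero (t : ATerm n) : Pv (eq (succ t) zero).not := by
  simpa using of_axiom PA.succ_ne_zero ![t]

theorem succ_inj (t s : ATerm n) : Pv ((eq (succ t) (succ s)).imp (eq t s)) := by
  simpa using of_axiom PA.succ_inj ![t, s]

theorem add_zero (t : ATerm n) : Pv (eq (add t zero) t) := by
  simpa using of_axiom PA.add_zero ![t]

theorem add_succ (t s : ATerm n) : Pv (eq (add t (succ s)) (succ (add t s))) := by
  simpa using of_axiom PA.add_succ ![t, s]

theorem mul_zero (t : ATerm n) : Pv (eq (mul t zero) zero) := by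
  simpa using of_axiom PA.mul_zero ![t]

theorem mul_succ (t s : ATerm n) : Pv (eq (mul t (succ s)) (add (mul t s) t)) := by
  simpa using of_axiom PA.mul_succ ![t, s]

theorem le_iff (t s : ATerm n) : Pv ((le t s).iff
    (BoundedFormula.ex (eq (add (x (Fin.last n)) (liftT t)) (liftT s)))) := by
  have := of_axiom PA.le_iff ![t, s]
  simp only [substF_iff, substF_le, substF_ex, substF_eq, substT_add, substT_x] at this
  exact this

/-- The only place where the induction scheme is invoked; everything else is carried out in Robinson
arithmetic. -/
theorem zero_or_succ (t : ATerm n) :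
    Pv ((eq t zero) ⊔ (BoundedFormula.ex (eq (liftT t) (succ (x (Fin.last n)))))) := by
  let φ : AFormula 1 := (eq (x 0) zero) ⊔ (BoundedFormula.ex (eq (x 0) (succ (x 1))))
  have subst_φ : ∀ {k : ℕ} (σ : Fin 1 → ATerm k), substF φ σ =
      (eq (σ 0) zero) ⊔ (BoundedFormula.ex (eq (liftT (σ 0)) (succ (x (Fin.last k))))) := by
    intro k σ
    simp only [φ, substF_sup, substF_eq, substF_ex, substT_succ, substT_x, substT_zero]
    rfl
  have h : Pv ((ProvLogic.inst φ zero).imp ((φ.imp (substF φ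
      (snoc (fun i => x i.castSucc) (succ (x (Fin.last 0)))))).all.imp φ.all)) :=
    of_alls (n := 0) (pv_sentence.2 (.hyp (PA.induction φ)))
  have base : Pv (ProvLogic.inst φ zero) := by
    rw [ProvLogic.inst, subst_φ]
    exact of_valuation fun v hv => (hv.sup _ _).2 (.inl (hv.of_derives _ (eq_refl _)))
  have step : Pv (substF φ (snoc (fun i => x i.castSucc) (succ (x (Fin.last 0))))) := by
    rw [subst_φ]
    refine of_valuation fun v hv => (hv.sup _ _).2 (.inr (hv.of_derives _ ?_))
    refine (imp_ex (x 0)).mp ?_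
    rw [inst_eq, substT_snoc_liftT, substT_id, substT_succ, substT_x, snoc_last]
    exact eq_refl _
  have := (((h.mp base).mp step.const.all).of_all).subst fun _ => t
  rwa [subst_φ] at this

/-- Case distinction: a number is zero or a successor. -/
theorem cases_zero_succ (t : ATerm n) (h₀ : Pv ((eq t zero).imp φ))
    (h₁ : Pv ((eq (liftT t) (succ (x (Fin.last n)))).imp (liftF φ))) : Pv φ := by
  refine of_valuation fun v hv => ?_
  have h₂ := hv.of_derives _ (zero_or_succ t)
  have h₃ := hv.of_derives _ (ex_imp h₁)
  have h₄ := hv.of_derives _ h₀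
  rw [hv.imp] at h₃ h₄
  rw [hv.sup] at h₂
  tauto

/-! ### Order -/

theorem le_of_add (t s r : ATerm n) : Pv ((eq (add r t) s).imp (le t s)) := by
  have h := imp_ex (φ := eq (add (x (Fin.last n)) (liftT t)) (liftT s)) r
  simp only [inst_eq, substT_add, substT_snoc_liftT, substT_id, substT_x, snoc_last] at h
  refine h.trans (of_valuation fun v hv => ?_)
  have := hv.of_derives _ (le_iff t s)
  rw [hv.iff] at this
  rw [hv.imp]
  exact this.2

theorem le_elim {t s : ATerm n}
    (h : Pv ((eq (add (x (Fin.last n)) (liftT t)) (liftT s)).imp (liftF φ))) :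
    Pv ((le t s).imp φ) := by
  refine trans (of_valuation fun v hv => ?_) (ex_imp h)
  have := hv.of_derives _ (le_iff t s)
  rw [hv.iff] at this
  rw [hv.imp]
  exact this.1

theorem zero_le (t : ATerm n) : Pv (le zero t) := (le_of_add zero t t).mp (add_zero t)

theorem not_succ_le_zero (t : ATerm n) : Pv (le (succ t) zero).not := by
  refine le_elim (φ := ⊥) (of_valuation fun v hv => ?_)
  have h₁ := hv.of_derives _ (add_succ (x (Fin.last n)) (liftT t))
  have h₂ := hv.of_derives _ (succ_ne_zero (add (x (Fin.last n)) (liftT t)))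
  have h₃ := hv.of_derives _ (eq_symm (add (x (Fin.last n)) (succ (liftT t)))
    (succ (add (x (Fin.last n)) (liftT t))))
  have h₄ := hv.of_derives _ (eq_trans (succ (add (x (Fin.last n)) (liftT t)))
    (add (x (Fin.last n)) (succ (liftT t))) zero)
  simp only [hv.imp, hv.not, liftT_succ, liftT_zero] at *
  tauto

theorem le_of_succ_le_succ (t s : ATerm n) : Pv ((le (succ t) (succ s)).imp (le t s)) := by
  refine le_elim (of_valuation fun v hv => ?_)
  have h₁ := hv.of_derives _ (add_succ (x (Fin.last n)) (liftT t))
  have h₂ := hv.of_derives _ (succ_inj (add (x (Fin.last n)) (liftT t)) (liftT s))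
  have h₃ := hv.of_derives _ (eq_symm (add (x (Fin.last n)) (succ (liftT t)))
    (succ (add (x (Fin.last n)) (liftT t))))
  have h₄ := hv.of_derives _ (eq_trans (succ (add (x (Fin.last n)) (liftT t)))
    (add (x (Fin.last n)) (succ (liftT t))) (succ (liftT s)))
  have h₅ := hv.of_derives _ (le_of_add (liftT t) (liftT s) (x (Fin.last n)))
  simp only [hv.imp, liftT_succ, liftF_le] at *
  tauto

theorem succ_le_succ (t s : ATerm n) : Pv ((le t s).imp (le (succ t) (succ s))) := by
  refine le_elim (of_valuation fun v hv => ?_)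
  have h₁ := hv.of_derives _ (add_succ (x (Fin.last n)) (liftT t))
  have h₂ := hv.of_derives _ (succ_congr (add (x (Fin.last n)) (liftT t)) (liftT s))
  have h₃ := hv.of_derives _ (eq_trans (add (x (Fin.last n)) (succ (liftT t)))
    (succ (add (x (Fin.last n)) (liftT t))) (succ (liftT s)))
  have h₄ := hv.of_derives _ (le_of_add (succ (liftT t)) (succ (liftT s)) (x (Fin.last n)))
  simp only [hv.imp, liftT_succ, liftF_le] at *
  tauto

/-! ### Numerals -/

theorem numeral_add (a b : ℕ) :
    Pv (eq (add (numeral a) (numeral b) : ATerm n) (numeral (a + b))) := by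
  induction b with
  | zero => exact add_zero _
  | succ b ih => exact (add_succ _ _).etrans ((succ_congr _ _).mp ih)

theorem numeral_mul (a b : ℕ) :
    Pv (eq (mul (numeral a) (numeral b) : ATerm n) (numeral (a * b))) := by
  induction b with
  | zero => exact mul_zero _
  | succ b ih =>
    exact (mul_succ _ _).etrans (((add_congr_left _ _ _).mp ih).etrans (numeral_add _ _))

theorem numeral_ne : ∀ {a b : ℕ}, a ≠ b → Pv (eq (numeral a : ATerm n) (numeral b)).not
  | 0, 0, h => (h rfl).elim
  | _ + 1, 0, _ => succ_ne_zero _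
  | 0, _ + 1, _ => (eq_symm _ _).trans (succ_ne_zero _)
  | _ + 1, _ + 1, h => (succ_inj _ _).trans (numeral_ne fun e => h (congrArg _ e))

theorem numeral_le {a b : ℕ} (h : a ≤ b) : Pv (le (numeral a : ATerm n) (numeral b)) := by
  refine (le_of_add _ _ (numeral (b - a))).mp ?_
  simpa only [Nat.sub_add_cancel h] using numeral_add (n := n) (b - a) a

/-- A number that is at most `k` is one of the numerals `0, …, k`. -/
theorem le_numeral_elim (k : ℕ) : ∀ {n : ℕ} {t : ATerm n} {φ : AFormula n},
    (∀ i ≤ k, Pv ((eq t (numeral i)).imp φ)) → Pv ((le t (numeral k)).imp φ) := by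
  induction k with
  | zero =>
    intro n t φ h
    refine cases_zero_succ t ?_ ?_
    · refine of_valuation fun v hv => ?_
      have := hv.of_derives _ (h 0 le_rfl)
      simp only [hv.imp, numeral] at *
      tauto
    · refine of_valuation fun v hv => ?_
      have h₁ := hv.of_derives _ (not_succ_le_zero (x (Fin.last n)))
      have h₂ := hv.of_derives _ (le_congr_left zero (liftT t) (succ (x (Fin.last n))))
      simp only [hv.imp, hv.not, numeral, liftF_imp, liftF_le, liftT_zero] at *
      tauto
  | succ k ih =>
    intro n t φ h
    refine cases_zero_succ t ?_ ?_
    · refine of_valuation fun v hv => ?_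
      have := hv.of_derives _ (h 0 (Nat.zero_le _))
      simp only [hv.imp, numeral] at *
      tauto
    -- With `t = S y`, the bound becomes `y ≤ k`. The induction hypothesis is applied to `y` in the
    -- extended context, with `t = S y` kept as a premise of the conclusion.
    · have key : Pv ((le (x (Fin.last n)) (numeral k)).imp
          ((eq (liftT t) (succ (x (Fin.last n)))).imp (liftF φ))) := by
        refine ih fun i hi => of_valuation fun v hv => ?_
        have h₁ := hv.of_derives _ (h (i + 1) (Nat.succ_le_succ hi)).lift
        have h₂ := hv.of_derives _ (succ_congr (x (Fin.last n)) (numeral i))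
        have h₃ := hv.of_derives _ (eq_trans (liftT t) (succ (x (Fin.last n))) (succ (numeral i)))
        simp only [hv.imp, numeral, liftF_imp, liftF_eq, liftT_succ, liftT_numeral] at *
        tauto
      refine of_valuation fun v hv => ?_
      have h₁ := hv.of_derives _ key
      have h₂ := hv.of_derives _ (le_of_succ_le_succ (x (Fin.last n)) (numeral k))
      have h₃ := hv.of_derives _ (le_congr_left (succ (numeral k)) (liftT t)
        (succ (x (Fin.last n))))
      simp only [hv.imp, numeral, liftF_imp, liftF_le, liftT_succ, liftT_numeral] at *
      tauto

theorem not_numeral_le {a b : ℕ} (h : ¬ a ≤ b) : Pv (le (numeral a : ATerm n) (numeral b)).not :=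
  le_numeral_elim b fun _ hi => numeral_ne fun e => h (e ▸ hi)

/-- Comparison with a numeral suffices, so the induction on `k` takes place outside `PA`. -/
theorem le_total_numeral (k : ℕ) : ∀ {n : ℕ} (t : ATerm n),
    Pv ((le t (numeral k)) ⊔ (le (numeral k) t)) := by
  induction k with
  | zero =>
    exact fun t => of_valuation fun v hv => (hv.sup _ _).2 (.inr (hv.of_derives _ (zero_le t)))
  | succ k ih =>
    intro n t
    refine cases_zero_succ t ?_ ?_
    · refine of_valuation fun v hv => ?_
      have h₁ := hv.of_derives _ (zero_le (numeral (k + 1) : ATerm n))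
      have h₂ := hv.of_derives _ (le_congr_left (numeral (k + 1)) zero t)
      have h₃ := hv.of_derives _ (eq_symm t zero)
      simp only [hv.imp, hv.sup] at *
      tauto
    · change Pv (BoundedFormula.imp _ ((liftF (le t _)) ⊔ (liftF (le _ t))))
      refine of_valuation fun v hv => ?_
      have h₁ := hv.of_derives _ (ih (x (Fin.last n)))
      have h₂ := hv.of_derives _ (succ_le_succ (x (Fin.last n)) (numeral k))
      have h₃ := hv.of_derives _ (succ_le_succ (numeral k) (x (Fin.last n)))
      have h₄ := hv.of_derives _ (eq_symm (liftT t) (succ (x (Fin.last n))))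
      have h₅ := hv.of_derives _ (le_congr_left (succ (numeral k)) (succ (x (Fin.last n)))
        (liftT t))
      have h₆ := hv.of_derives _ (le_congr_right (succ (numeral k)) (succ (x (Fin.last n)))
        (liftT t))
      simp only [hv.imp, hv.sup, numeral, liftF_le, liftT_succ, liftT_numeral] at *
      tauto

end Pv

/-! ### Binumerable relations and representable functions -/

section Representability

variable {n m k : ℕ}

/-- The numerals of the entries of a vector. -/
def nums (v : Fin n → ℕ) : Fin n → ATerm m := fun i => numeral (v i)

theorem liftT_nums (v : Fin n → ℕ) : (fun i => liftT (nums v i : ATerm m)) = nums v := by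
  funext i
  simp [nums]

theorem nums_snoc (v : Fin n → ℕ) (a : ℕ) :
    (nums (Fin.snoc v a : Fin (n + 1) → ℕ) : Fin (n + 1) → ATerm m) =
      snoc (nums v) (numeral a) := by
  funext i
  refine Fin.lastCases ?_ (fun i => ?_) i <;> simp [nums]

/-- The relation `R` is binumerable in Peano arithmetic. -/
def Dec (R : (Fin n → ℕ) → Prop) : Prop :=
  ∃ θ : AFormula n, ∀ (v : Fin n → ℕ) (m : ℕ),
    (R v → Pv (substF θ (nums v) : AFormula m)) ∧ (¬ R v → Pv (substF θ (nums v) : AFormula m).not)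

/-- The graph of the function `f` is binumerable in Peano arithmetic. -/
def Rep (f : (Fin n → ℕ) → ℕ) : Prop :=
  Dec fun w : Fin (n + 1) → ℕ => w (Fin.last n) = f (Fin.init w)

/-- Isolates the last slot of the formula, where `Pv.eq_subst` can later exchange a numeral for an
arbitrary term. -/
theorem Dec.exists_snoc {R : (Fin n → ℕ) → ℕ → Prop}
    (h : Dec fun w : Fin (n + 1) → ℕ => R (Fin.init w) (w (Fin.last n))) :
    ∃ θ : AFormula (n + 1), ∀ (v : Fin n → ℕ) (a m : ℕ),
      (R v a → Pv (substF θ (snoc (nums v) (numeral a)) : AFormula m)) ∧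
        (¬ R v a → Pv (substF θ (snoc (nums v) (numeral a)) : AFormula m).not) := by
  obtain ⟨θ, h⟩ := h
  refine ⟨θ, fun v a m => ?_⟩
  have := h (Fin.snoc v a) m
  simpa only [nums_snoc, Fin.init_snoc, Fin.snoc_last] using this

namespace Dec

theorem not {R : (Fin n → ℕ) → Prop} (h : Dec R) : Dec fun v => ¬ R v := by
  obtain ⟨θ, h⟩ := h
  refine ⟨θ.not, fun v m => ⟨(h v m).2, fun hR => ?_⟩⟩
  refine Pv.of_valuation fun v hv => ?_
  have := hv.of_derives _ ((h _ m).1 (not_not.1 hR))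
  simpa only [substF_not, hv.not, not_not]

theorem and {R S : (Fin n → ℕ) → Prop} (hR : Dec R) (hS : Dec S) : Dec fun v => R v ∧ S v := by
  obtain ⟨θ, hR⟩ := hR
  obtain ⟨η, hS⟩ := hS
  refine ⟨θ ⊓ η, fun v m => ⟨fun h => Pv.of_valuation fun u hu => ?_,
    fun h => Pv.of_valuation fun u hu => ?_⟩⟩
  · have h₁ := hu.of_derives _ ((hR v m).1 h.1)
    have h₂ := hu.of_derives _ ((hS v m).1 h.2)
    simp only [substF_inf, hu.inf]
    tauto
  · simp only [substF_inf, hu.inf, hu.not]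
    rcases not_and_or.1 h with h | h
    · have h₁ := hu.of_derives _ ((hR v m).2 h)
      rw [hu.not] at h₁
      tauto
    · have h₁ := hu.of_derives _ ((hS v m).2 h)
      rw [hu.not] at h₁
      tauto

theorem congr {R S : (Fin n → ℕ) → Prop} (hR : Dec R) (h : ∀ v, S v ↔ R v) : Dec S := by
  rwa [show S = R from funext fun v => propext (h v)]

theorem or {R S : (Fin n → ℕ) → Prop} (hR : Dec R) (hS : Dec S) : Dec fun v => R v ∨ S v :=
  (hR.not.and hS.not).not.congr fun v => by tauto

theorem imp {R S : (Fin n → ℕ) → Prop} (hR : Dec R) (hS : Dec S) : Dec fun v => R v → S v :=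
  (hR.and hS.not).not.congr fun v => by tauto

theorem reindex {R : (Fin n → ℕ) → Prop} (hR : Dec R) (ρ : Fin n → Fin k) :
    Dec fun v => R fun i => v (ρ i) := by
  obtain ⟨θ, h⟩ := hR
  refine ⟨substF θ fun i => x (ρ i), fun v m => ?_⟩
  rw [substF_substF]
  exact h _ m

/-- Once the bound is a numeral, `Pv.le_numeral_elim` turns the bounded quantifier into finitely
many decided instances. -/
theorem ball_var {R : (Fin n → ℕ) → ℕ → Prop}
    (h : Dec fun w : Fin (n + 1) → ℕ => R (Fin.init w) (w (Fin.last n))) (j : Fin n) :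
    Dec fun v => ∀ y ≤ v j, R v y := by
  obtain ⟨θ, h⟩ := h.exists_snoc
  refine ⟨((le (x (Fin.last n)) (x j.castSucc)).imp θ).all, fun v m => ?_⟩
  rw [substF_all, liftT_nums, substF_imp, substF_le, substT_x, substT_x, snoc_last, snoc_castSucc]
  constructor
  · refine fun hR => Pv.all (Pv.le_numeral_elim _ fun i hi => ?_)
    refine Pv.of_valuation fun u hu => ?_
    have h₁ := hu.of_derives _ ((h v i (m + 1)).1 (hR i hi))
    have h₂ := hu.of_derives _ (Pv.eq_subst (numeral i) (x (Fin.last m)) (nums v) θ)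
    have h₃ := hu.of_derives _ (Pv.eq_symm (x (Fin.last m)) (numeral i))
    simp only [hu.imp] at *
    tauto
  · intro hR
    push Not at hR
    obtain ⟨y, hy, hR⟩ := hR
    have h₁ := Pv.all_imp (φ := (le (x (Fin.last m)) (nums v j)).imp
      (substF θ (snoc (nums v) (x (Fin.last m))))) (numeral y)
    rw [inst, substF_imp, substF_substF, substT_comp_snoc, substF_le, substT_x, snoc_last] at h₁
    simp only [nums, substT_numeral] at h₁
    refine Pv.of_valuation fun u hu => ?_
    have h₁ := hu.of_derives _ h₁
    have h₂ := hu.of_derives _ ((h v y m).2 hR)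
    have h₃ := hu.of_derives _ (Pv.numeral_le (n := m) hy)
    simp only [hu.imp, hu.not] at *
    tauto

end Dec

/-- A representable function has a formula for which Peano arithmetic proves uniqueness. -/
theorem Rep.exists_formula {f : (Fin n → ℕ) → ℕ} (hf : Rep f) :
    ∃ D : AFormula (n + 1), ∀ (v : Fin n → ℕ) (m : ℕ) (t : ATerm m),
      Pv ((substF D (snoc (nums v) t)).iff (eq t (numeral (f v)))) := by
  obtain ⟨θ, h⟩ := Dec.exists_snoc (R := fun v a => a = f v) hf
  -- The new formula says that the last variable is the least witness of `θ`. Minimality supplies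
  -- the provable uniqueness that binumerability of the graph does not give.
  refine ⟨θ ⊓ ((le (x (Fin.last (n + 1))) (x (Fin.last n).castSucc)).imp
    ((substF θ (snoc (fun i => x i.castSucc.castSucc) (x (Fin.last (n + 1))))).imp
      (eq (x (Fin.last (n + 1))) (x (Fin.last n).castSucc)))).all, fun v m t => ?_⟩
  have e : substF (θ ⊓ ((le (x (Fin.last (n + 1))) (x (Fin.last n).castSucc)).imp
      ((substF θ (snoc (fun i => x i.castSucc.castSucc) (x (Fin.last (n + 1))))).imp
        (eq (x (Fin.last (n + 1))) (x (Fin.last n).castSucc)))).all) (snoc (nums v) t) =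
      substF θ (snoc (nums v) t) ⊓ ((le (x (Fin.last m)) (liftT t)).imp
        ((substF θ (snoc (nums v) (x (Fin.last m)))).imp
          (eq (x (Fin.last m)) (liftT t)))).all := by
    rw [substF_inf, substF_all]
    simp only [substF_imp, substF_le, substF_eq, substT_x, snoc_last, snoc_castSucc, substF_substF,
      substT_comp_snoc]
    rw [← liftT_nums v]
  rw [e]
  -- At most `f v`, there are only numerals, and `θ` is refuted at each of them except `f v`.
  have elim : ∀ {k : ℕ} (s : ATerm k), Pv ((le s (numeral (f v))).imp
      ((substF θ (snoc (nums v) s)).imp (eq s (numeral (f v))))) := by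
    intro k s
    refine Pv.le_numeral_elim _ fun i _ => ?_
    rcases eq_or_ne i (f v) with rfl | hne
    · exact Pv.of_valuation fun u hu => by simp only [hu.imp]; tauto
    · refine Pv.of_valuation fun u hu => ?_
      have h₁ := hu.of_derives _ ((h v i k).2 hne)
      have h₂ := hu.of_derives _ (Pv.eq_subst s (numeral i) (nums v) θ)
      simp only [hu.imp, hu.not] at *
      tauto
  have unique : Pv ((eq t (numeral (f v))).imp ((le (x (Fin.last m)) (liftT t)).imp
      ((substF θ (snoc (nums v) (x (Fin.last m)))).imp
        (eq (x (Fin.last m)) (liftT t)))).all) := by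
    refine Pv.imp_all (Pv.of_valuation fun u hu => ?_)
    have h₁ := hu.of_derives _ (elim (x (Fin.last m)))
    have h₂ := hu.of_derives _ (Pv.le_congr_right (x (Fin.last m)) (liftT t) (numeral (f v)))
    have h₃ := hu.of_derives _ (Pv.eq_symm (liftT t) (numeral (f v)))
    have h₄ := hu.of_derives _ (Pv.eq_trans (x (Fin.last m)) (numeral (f v)) (liftT t))
    simp only [hu.imp, liftF_eq, liftT_numeral] at *
    tauto
  have least := Pv.all_imp (φ := (le (x (Fin.last m)) (liftT t)).imp
    ((substF θ (snoc (nums v) (x (Fin.last m)))).imp (eq (x (Fin.last m)) (liftT t))))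
    (numeral (f v))
  rw [inst, substF_imp, substF_imp, substF_substF, substT_comp_snoc, substF_le, substF_eq,
    substT_x, snoc_last, substT_snoc_liftT, substT_id] at least
  simp only [nums, substT_numeral] at least
  refine Pv.of_valuation fun u hu => ?_
  have h₁ := hu.of_derives _ least
  have h₂ := hu.of_derives _ unique
  have h₃ := hu.of_derives _ (elim t)
  have h₄ := hu.of_derives _ (Pv.le_total_numeral (f v) t)
  have h₅ := hu.of_derives _ (Pv.eq_subst (numeral (f v)) t (nums v) θ)
  have h₆ := hu.of_derives _ (Pv.eq_symm t (numeral (f v)))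
  have h₇ := hu.of_derives _ (Pv.eq_symm (numeral (f v)) t)
  have h₈ := hu.of_derives _ ((h v (f v) m).1 rfl)
  simp only [hu.imp, hu.sup, hu.inf, hu.iff] at h₁ h₂ h₃ h₄ h₅ h₆ h₇ h₈ ⊢
  -- Compare `t` with the numeral of `f v`: if `t` is at most it, `elim` applies; otherwise
  -- minimality of `t` makes them equal.
  exact ⟨fun hD => h₄.elim (fun hl => h₃ hl hD.1) fun hl => h₇ (h₁ hD.2 hl h₈),
    fun ht => ⟨h₅ (h₆ ht) h₈, h₂ ht⟩⟩

namespace Dec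

/-- The formula `∀ y, D(v, y) → θ(v, y)` works because `D(v, y)` is provably equivalent to `y` being
the numeral of `f v`. -/
theorem comp {R : (Fin n → ℕ) → ℕ → Prop}
    (h : Dec fun w : Fin (n + 1) → ℕ => R (Fin.init w) (w (Fin.last n)))
    {f : (Fin n → ℕ) → ℕ} (hf : Rep f) : Dec fun v => R v (f v) := by
  obtain ⟨θ, h⟩ := h.exists_snoc
  obtain ⟨D, hD⟩ := hf.exists_formula
  refine ⟨(D.imp θ).all, fun v m => ?_⟩
  rw [substF_all, liftT_nums, substF_imp]
  constructor
  · refine fun hR => Pv.all (Pv.of_valuation fun u hu => ?_)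
    have h₁ := hu.of_derives _ ((h v (f v) (m + 1)).1 hR)
    have h₂ := hu.of_derives _ (hD v (m + 1) (x (Fin.last m)))
    have h₃ := hu.of_derives _ (Pv.eq_symm (x (Fin.last m)) (numeral (f v)))
    have h₄ := hu.of_derives _ (Pv.eq_subst (numeral (f v)) (x (Fin.last m)) (nums v) θ)
    simp only [hu.imp, hu.iff] at *
    tauto
  · intro hR
    have h₁ := Pv.all_imp (φ := (substF D (snoc (nums v) (x (Fin.last m)))).imp
      (substF θ (snoc (nums v) (x (Fin.last m))))) (numeral (f v))
    rw [inst, substF_imp, substF_substF, substF_substF, substT_comp_snoc, substT_x, snoc_last] at h₁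
    simp only [nums, substT_numeral] at h₁
    refine Pv.of_valuation fun u hu => ?_
    have h₁ := hu.of_derives _ h₁
    have h₂ := hu.of_derives _ ((h v (f v) m).2 hR)
    have h₃ := hu.of_derives _ (hD v m (numeral (f v)))
    have h₄ := hu.of_derives _ (Pv.eq_refl (numeral (f v) : ATerm m))
    simp only [hu.imp, hu.not, hu.iff] at *
    tauto

/-- Inserts a dummy variable just before the last one. -/
theorem init {R : (Fin n → ℕ) → ℕ → Prop}
    (h : Dec fun w : Fin (n + 1) → ℕ => R (Fin.init w) (w (Fin.last n))) :
    Dec fun w : Fin (n + 2) → ℕ => R (Fin.init (Fin.init w)) (w (Fin.last (n + 1))) := by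
  refine (h.reindex (k := n + 2) (Fin.snoc (α := fun _ => Fin (n + 2))
      (fun i => i.castSucc.castSucc) (Fin.last (n + 1)))).congr fun w => ?_
  simp only [Fin.snoc_last]
  have e : (Fin.init fun i => w (Fin.snoc (α := fun _ => Fin (n + 2))
      (fun i => i.castSucc.castSucc) (Fin.last (n + 1)) i)) = Fin.init (Fin.init w) := by
    funext i
    simp [Fin.init]
  rw [e]

theorem comp₂ {R : ℕ → ℕ → Prop} (hR : Dec fun w : Fin 2 → ℕ => R (w 0) (w 1))
    {f g : (Fin n → ℕ) → ℕ} (hf : Rep f) (hg : Rep g) : Dec fun v => R (f v) (g v) := by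
  refine comp (R := fun v y => R (f v) y) ?_ hg
  refine comp (n := n + 1) (R := fun w z => R z (w (Fin.last n)))
    (f := fun w => f (Fin.init w)) ?_ ?_
  · exact hR.reindex ![Fin.last (n + 1), (Fin.last n).castSucc]
  · exact hf.init (R := fun v a => a = f v)

/-- The value of the bound is made an extra variable, so that `ball_var` applies, and is then
eliminated by `comp`. -/
theorem ball {R : (Fin n → ℕ) → ℕ → Prop} {b : (Fin n → ℕ) → ℕ} (hb : Rep b)
    (h : Dec fun w : Fin (n + 1) → ℕ => R (Fin.init w) (w (Fin.last n))) :
    Dec fun v => ∀ y ≤ b v, R v y := by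
  refine comp (R := fun v c => ∀ y ≤ c, R v y) ?_ hb
  refine ball_var (n := n + 1) (R := fun w y => R (Fin.init w) y) ?_ (Fin.last n)
  exact h.init

theorem bex {R : (Fin n → ℕ) → ℕ → Prop} {b : (Fin n → ℕ) → ℕ} (hb : Rep b)
    (h : Dec fun w : Fin (n + 1) → ℕ => R (Fin.init w) (w (Fin.last n))) :
    Dec fun v => ∃ y ≤ b v, R v y :=
  (ball (R := fun v y => ¬ R v y) hb h.not).not.congr fun v => by push Not; rfl

theorem eq_var (i j : Fin n) : Dec fun v => v i = v j :=
  ⟨eq (x i) (x j), fun v m => ⟨fun h => by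
    simp only [substF_eq, substT_x, nums, h]; exact Pv.eq_refl _, Pv.numeral_ne⟩⟩

theorem le_var (i j : Fin n) : Dec fun v => v i ≤ v j :=
  ⟨le (x i) (x j), fun v m => by
    rw [substF_le]; exact ⟨Pv.numeral_le, Pv.not_numeral_le⟩⟩

/-- Equality of a variable with the value of a term. -/
theorem eq_term (i : Fin n) (t : ATerm n) (f : (Fin n → ℕ) → ℕ)
    (h : ∀ (v : Fin n → ℕ) (m : ℕ), Pv (eq (substT (nums v) t) (numeral (f v)) : AFormula m)) :
    Dec fun v => v i = f v := by
  refine ⟨eq (x i) t, fun v m => ⟨fun e => ?_, fun e => ?_⟩⟩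
  · simp only [substF_eq, substT_x, nums, e]
    exact (h v m).symm
  · refine Pv.of_valuation fun u hu => ?_
    have h₁ := hu.of_derives _ (h v m)
    have h₂ := hu.of_derives _ (Pv.eq_trans (numeral (v i)) (substT (nums v) t) (numeral (f v)))
    have h₃ := hu.of_derives _ (Pv.numeral_ne (n := m) e)
    simp only [hu.imp, hu.not, substF_eq, substT_x, nums] at *
    tauto

end Dec

namespace Rep

theorem var (i : Fin n) : Rep fun v => v i := Dec.eq_var (Fin.last n) i.castSucc

theorem const (c : ℕ) : Rep fun _ : Fin n → ℕ => c :=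
  Dec.eq_term _ (numeral c) _ fun v m => by
    rw [substT_numeral]; exact Pv.eq_refl _

theorem init {f : (Fin n → ℕ) → ℕ} (hf : Rep f) : Rep fun w : Fin (n + 1) → ℕ => f (Fin.init w) :=
  Dec.init (R := fun v a => a = f v) hf

theorem comp₁ {g : ℕ → ℕ} (hg : Rep fun w : Fin 1 → ℕ => g (w 0)) {f : (Fin n → ℕ) → ℕ}
    (hf : Rep f) : Rep fun v => g (f v) :=
  Dec.comp₂ (R := fun a b => b = g a) hg hf.init (var _)

theorem comp₂ {g : ℕ → ℕ → ℕ} (hg : Rep fun w : Fin 2 → ℕ => g (w 0) (w 1))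
    {f₁ f₂ : (Fin n → ℕ) → ℕ} (h₁ : Rep f₁) (h₂ : Rep f₂) : Rep fun v => g (f₁ v) (f₂ v) := by
  refine Dec.comp (n := n + 1) (R := fun w b => w (Fin.last n) = g (f₁ (Fin.init w)) b)
    (f := fun w => f₂ (Fin.init w)) ?_ h₂.init
  refine Dec.comp (n := n + 2) (R := fun u a => u (Fin.last n).castSucc = g a (u (Fin.last _)))
    (f := fun u => f₁ (Fin.init (Fin.init u))) ?_ h₁.init.init
  -- The variables are, in order, `v`, the output, the value of `f₂` and the value of `f₁`.
  exact Dec.reindex hg ![Fin.last (n + 2), (Fin.last (n + 1)).castSucc,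
    (Fin.last n).castSucc.castSucc]

end Rep

/-! ### Closure of the representable functions, up to primitive recursion -/

variable {f g h : (Fin n → ℕ) → ℕ}

theorem Dec.eq (hf : Rep f) (hg : Rep g) : Dec fun v => f v = g v :=
  comp₂ (R := fun a b => a = b) (eq_var 0 1) hf hg

theorem Dec.le (hf : Rep f) (hg : Rep g) : Dec fun v => f v ≤ g v :=
  comp₂ (R := fun a b => a ≤ b) (le_var 0 1) hf hg

theorem Dec.lt (hf : Rep f) (hg : Rep g) : Dec fun v => f v < g v :=
  (le hg hf).not.congr fun _ => not_le.symm

namespace Rep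

theorem add (hf : Rep f) (hg : Rep g) : Rep fun v => f v + g v :=
  comp₂ (g := fun a b => a + b) (Dec.eq_term _ (ProvLogic.add (x 0) (x 1))
    (fun w : Fin 3 → ℕ => w 0 + w 1) fun v m => by
      simpa [nums] using Pv.numeral_add (v 0) (v 1)) hf hg

theorem mul (hf : Rep f) (hg : Rep g) : Rep fun v => f v * g v :=
  comp₂ (g := fun a b => a * b) (Dec.eq_term _ (ProvLogic.mul (x 0) (x 1))
    (fun w : Fin 3 → ℕ => w 0 * w 1) fun v m => by
      simpa [nums] using Pv.numeral_mul (v 0) (v 1)) hf hg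

theorem succ (hf : Rep f) : Rep fun v => f v + 1 := hf.add (const 1)

theorem pair (hf : Rep f) (hg : Rep g) : Rep fun v => Nat.pair (f v) (g v) := by
  refine comp₂ (g := Nat.pair) ?_ hf hg
  refine ((((Dec.lt (var 0) (var 1)).and (Dec.eq (var 2) (((var 1).mul (var 1)).add (var 0)))).or
    ((Dec.le (var 1) (var 0)).and (Dec.eq (var 2)
      ((((var 0).mul (var 0)).add (var 0)).add (var 1))))) : Dec (n := 3) _).congr fun w => ?_
  change w 2 = Nat.pair (w 0) (w 1) ↔ _
  rw [Nat.pair]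
  split_ifs with h <;> omega

/-- Components never exceed the pair, so a bounded search for the other component defines the graph.
-/
theorem left (hf : Rep f) : Rep fun v => (f v).unpair.1 := by
  refine comp₁ (g := fun a => a.unpair.1) ?_ hf
  refine (Dec.bex (n := 2) (var 0) (R := fun v b => v 0 = Nat.pair (v 1) b)
    (Dec.eq (n := 3) (var 0) ((var 1).pair (var 2)))).congr fun w => ?_
  change w 1 = (w 0).unpair.1 ↔ _
  constructor
  · exact fun h => ⟨(w 0).unpair.2, Nat.unpair_right_le _, by rw [h, Nat.pair_unpair]⟩
  · rintro ⟨b, -, h⟩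
    rw [h, Nat.unpair_pair]

theorem right (hf : Rep f) : Rep fun v => (f v).unpair.2 := by
  refine comp₁ (g := fun a => a.unpair.2) ?_ hf
  refine (Dec.bex (n := 2) (var 0) (R := fun v b => v 0 = Nat.pair b (v 1))
    (Dec.eq (n := 3) (var 0) ((var 2).pair (var 1)))).congr fun w => ?_
  change w 1 = (w 0).unpair.2 ↔ _
  constructor
  · exact fun h => ⟨(w 0).unpair.1, Nat.unpair_left_le _, by rw [h, Nat.pair_unpair]⟩
  · rintro ⟨b, -, h⟩
    rw [h, Nat.unpair_pair]

/-- The successor keeps the divisor positive, and the quotient is bounded by the dividend. This is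
the form of remainder that occurs in the β function. -/
theorem mod_succ (hf : Rep f) (hg : Rep g) : Rep fun v => f v % (g v + 1) := by
  refine comp₂ (g := fun a b => a % (b + 1)) ?_ hf hg
  refine ((Dec.le (var 2) (var 1)).and (Dec.bex (n := 3) (var 0)
    (R := fun v q => v 0 = (v 1 + 1) * q + v 2)
    (Dec.eq (n := 4) (var 0) (((var 1).succ.mul (var 3)).add (var 2))))).congr fun w => ?_
  change w 2 = w 0 % (w 1 + 1) ↔ _
  constructor
  · intro h
    refine ⟨?_, w 0 / (w 1 + 1), Nat.div_le_self _ _, ?_⟩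
    · rw [h]
      exact Nat.le_of_lt_succ (Nat.mod_lt _ (Nat.succ_pos _))
    · rw [h, Nat.div_add_mod]
  · rintro ⟨hl, q, -, h⟩
    rw [h, Nat.mul_add_mod, Nat.mod_eq_of_lt (by omega)]

theorem beta (hf : Rep f) (hg : Rep g) : Rep fun v => Nat.beta (f v) (g v) :=
  hf.left.mod_succ (hg.succ.mul hf.right)

/-- The least witness has a decidable graph: minimality is a quantifier bounded by the value itself.
-/
theorem exists_of_dec {R : (Fin n → ℕ) → ℕ → Prop}
    (hR : Dec fun w : Fin (n + 1) → ℕ => R (Fin.init w) (w (Fin.last n)))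
    (hex : ∀ v, ∃ y, R v y) : ∃ f : (Fin n → ℕ) → ℕ, Rep f ∧ ∀ v, R v (f v) := by
  classical
  refine ⟨fun v => Nat.find (hex v), ?_, fun v => Nat.find_spec (hex v)⟩
  refine (hR.and (Dec.ball (var (Fin.last n))
    (R := fun w y => R (Fin.init w) y → y = w (Fin.last n))
    (hR.init.imp (Dec.eq (var (Fin.last (n + 1))) (var (Fin.last n).castSucc))))).congr fun w => ?_
  rw [eq_comm, Nat.find_eq_iff]
  refine and_congr_right fun _ => forall_congr' fun y => ?_
  constructor
  · exact fun h hy hR => by_contra fun hne => h (lt_of_le_of_ne hy hne) hR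
  · exact fun h hy hR => hy.ne (h hy.le hR)

/-- Every primitive recursive function is representable. -/
theorem of_primrec {F : ℕ → ℕ} (hF : Nat.Primrec F) : Rep fun w : Fin 1 → ℕ => F (w 0) := by
  induction hF with
  | zero => exact const 0
  | succ => exact (var 0).succ
  | left => exact (var 0).left
  | right => exact (var 0).right
  | pair _ _ h₁ h₂ => exact h₁.pair h₂
  | comp _ _ h₁ h₂ => exact comp₁ h₁ h₂
  | @prec f g _ _ h₁ h₂ =>
    let F : ℕ → ℕ → ℕ := fun z n => n.rec (f z) fun y IH => g (Nat.pair z (Nat.pair y IH))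
    refine comp₂ (g := F) ?_ (var 0).left (var 0).right
    -- `s` chooses a β-code of the course of values of the recursion up to `v 1`. The clause `i < v
    -- 1` compensates for bounded quantification being available only with `≤`; `Nat.unbeta` shows
    -- that a code exists.
    obtain ⟨s, hs, good⟩ := exists_of_dec (n := 2)
      (R := fun v s => Nat.beta s 0 = f (v 0) ∧ ∀ i ≤ v 1, i < v 1 →
        Nat.beta s (i + 1) = g (Nat.pair (v 0) (Nat.pair i (Nat.beta s i))))
      ((Dec.eq (n := 3) ((var 2).beta (const 0)) (comp₁ h₁ (var 0))).and
        (Dec.ball (n := 3) (var 1) (R := fun v i => i < v 1 → Nat.beta (v 2) (i + 1) =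
            g (Nat.pair (v 0) (Nat.pair i (Nat.beta (v 2) i))))
          ((Dec.lt (n := 4) (var 3) (var 1)).imp (Dec.eq ((var 2).beta (var 3).succ)
            (comp₁ h₂ ((var 0).pair ((var 3).pair ((var 2).beta (var 3)))))))))
      (by
        intro v
        let l := (List.range (v 1 + 1)).map (F (v 0))
        have hl : ∀ i ≤ v 1, Nat.beta (Nat.unbeta l) i = F (v 0) i := by
          intro i hi
          have := Nat.beta_unbeta_coe l ⟨i, by simp [l]; omega⟩
          simpa [l] using this
        refine ⟨Nat.unbeta l, hl 0 (Nat.zero_le _), fun i hi hi' => ?_⟩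
        rw [hl i hi, hl (i + 1) hi'])
    -- Codes are not unique, but the recursion equations determine every entry up to `v 1`.
    have key : ∀ v : Fin 2 → ℕ, F (v 0) (v 1) = Nat.beta (s v) (v 1) := by
      intro v
      have : ∀ i ≤ v 1, Nat.beta (s v) i = F (v 0) i := by
        intro i
        induction i with
        | zero => exact fun _ => (good v).1
        | succ i ih =>
          intro hi
          rw [(good v).2 i (by omega) hi, ih (by omega)]
      exact (this _ le_rfl).symm
    simp only [key]
    exact hs.beta (var 1)

end Rep

end Representability

/-! ### Gödel numbers of substitution instances -/

section GodelNumbers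

theorem strT_numeral_zero {n : ℕ} : strT (numeral 0 : ATerm n) = [0] := by
  simp [numeral, zero, strT, funcNum]

theorem strT_numeral_succ {n : ℕ} (k : ℕ) :
    strT (numeral (k + 1) : ATerm n) = 1 :: strT (numeral k : ATerm n) := by
  simp [numeral, succ, strT, funcNum, List.finRange_succ]

theorem primrec_strT_numeral (n : ℕ) : Primrec fun k : ℕ => strT (numeral k : ATerm n) := by
  refine (Primrec.nat_rec₁ [0] (f := fun _ l => 1 :: l)
    (Primrec.list_cons.comp (Primrec.const 1) Primrec.snd)).of_eq fun k => ?_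
  induction k with
  | zero => exact strT_numeral_zero.symm
  | succ k ih => rw [strT_numeral_succ, ← ih]

theorem primrec_flatMap {ι : Type*} {F : ι → ℕ → List ℕ} (h : ∀ i, Primrec (F i)) (l : List ι) :
    Primrec fun k => l.flatMap fun i => F i k := by
  induction l with
  | nil => exact Primrec.const []
  | cons i l ih => simpa only [List.flatMap_cons] using Primrec.list_append.comp (h i) ih

theorem primrec_strT_substT {n m : ℕ} {σ : ℕ → Fin n → ATerm m}
    (h : ∀ i, Primrec fun k => strT (σ k i)) (t : ATerm n) :
    Primrec fun k => strT (substT (σ k) t) := by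
  induction t with
  | var i => rcases i with i | i; exacts [i.elim, h i]
  | func f ts ih =>
    simp only [substT, Term.subst, strT]
    exact Primrec.list_cons.comp (Primrec.const _) (primrec_flatMap ih _)

/-- Variables are numbered from the outermost binder inwards, so a fresh last variable leaves the
existing symbols unchanged. -/
theorem strT_liftT {n : ℕ} (t : ATerm n) : strT (liftT t) = strT t := by
  induction t with
  | var i => rcases i with i | i; exacts [i.elim, by simp [liftT, substT, Term.subst, x, strT] ]
  | func f ts ih =>
    simp only [liftT, substT, Term.subst, strT] at ih ⊢
    simp only [ih]

/-- The formula is fixed and only the substituted terms depend on `k`, so structural induction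
replaces any recursion on codes. -/
theorem primrec_strF_substF {n : ℕ} (φ : AFormula n) : ∀ {m : ℕ} {σ : ℕ → Fin n → ATerm m},
    (∀ i, Primrec fun k => strT (σ k i)) → Primrec fun k => strF (substF φ (σ k)) := by
  induction φ with
  | falsum => exact fun _ => Primrec.const _
  | equal t s =>
    intro m σ h
    simp only [substF, strF]
    exact Primrec.list_cons.comp (Primrec.const _)
      (Primrec.list_append.comp (primrec_strT_substT h t) (primrec_strT_substT h s))
  | rel R ts =>
    intro m σ h
    simp only [substF, strF]
    exact Primrec.list_cons.comp (Primrec.const _)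
      (primrec_flatMap (fun i => primrec_strT_substT h (ts i)) _)
  | imp φ ψ h₁ h₂ =>
    intro m σ h
    simp only [substF, strF]
    exact Primrec.list_cons.comp (Primrec.const _) (Primrec.list_append.comp (h₁ h) (h₂ h))
  | all φ ih =>
    intro m σ h
    simp only [substF, strF]
    refine Primrec.list_cons.comp (Primrec.const _) (Primrec.list_cons.comp (Primrec.const _)
      (ih fun i => ?_))
    refine Fin.lastCases ?_ (fun i => ?_) i
    · simpa only [snoc_last] using Primrec.const _
    · simpa only [snoc_castSucc, strT_liftT] using h i

/-- The diagonalization `∀ x₀, x₀ = ⌜θ⌝ → θ` of `θ`. -/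
def diag (θ : AFormula 1) : ASentence := ((eq (x 0) (quote θ)).imp θ).all

theorem exists_primrec_diag :
    ∃ d : ℕ → ℕ, Nat.Primrec d ∧ ∀ θ : AFormula 1, d (godelNum θ) = godelNum (diag θ) := by
  -- The prefix spells `∀ x₀ → = x₀`, and is followed by the numeral and the unchanged string of
  -- `θ`. This form of diagonalization avoids substitution on codes; the default `[]` plays no role
  -- at Gödel numbers.
  refine ⟨fun k => Encodable.encode (8 :: 9 :: 7 :: 5 :: 9 :: (strT (numeral k : ATerm 1) ++
    (Encodable.decode (α := List ℕ) k).getD [])), Primrec.nat_iff.1 ?_, fun θ => ?_⟩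
  · exact Primrec.encode.comp (Primrec.list_cons.comp (Primrec.const _) (Primrec.list_cons.comp
      (Primrec.const _) (Primrec.list_cons.comp (Primrec.const _) (Primrec.list_cons.comp
      (Primrec.const _) (Primrec.list_cons.comp (Primrec.const _) (Primrec.list_append.comp
      (primrec_strT_numeral 1) (Primrec.option_getD.comp Primrec.decode (Primrec.const []))))))))
  · simp [godelNum, diag, strF, eq, x, strT, varNum, quote]

theorem primrec_godelNum_app (Pr : AFormula 1) :
    Nat.Primrec fun k => godelNum (app Pr (numeral k)) :=
  Primrec.nat_iff.1 (Primrec.encode.comp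
    (primrec_strF_substF Pr (σ := fun k _ => numeral k) fun _ => primrec_strT_numeral 0))

end GodelNumbers

/-! ### Self-reference -/

theorem snoc_elim0 {m : ℕ} (σ : Fin 0 → ATerm m) (t : ATerm m) : snoc σ t = fun _ => t := by
  funext i
  rw [show i = Fin.last 0 from Fin.fin_one_eq_zero i, snoc_last]

theorem eq_subst_app {m : ℕ} (φ : AFormula 1) (t s : ATerm m) :
    Pv ((eq t s).imp ((substF φ fun _ => t).imp (substF φ fun _ => s))) := by
  have := Pv.eq_subst t s Fin.elim0 φ
  rwa [snoc_elim0, snoc_elim0] at this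

/-- The one-point rule: quantifying over the `x₀` equal to `⌜θ⌝` amounts to substituting `⌜θ⌝`. -/
theorem pv_diag (θ : AFormula 1) : Pv ((diag θ).iff (app θ (quote θ))) := by
  have h₁ : Pv ((diag θ).imp _) := Pv.all_imp (quote θ)
  have h₂ : Pv ((app θ (quote θ)).imp (diag θ)) := by
    refine Pv.imp_all (Pv.of_valuation fun u hu => ?_)
    have h₃ := hu.of_derives _ (eq_subst_app θ (quote θ) (x 0))
    have h₄ := hu.of_derives _ (Pv.eq_symm (x 0) (quote θ : ATerm 1))
    rw [show (fun _ => x 0 : Fin 1 → ATerm 1) = x from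
      funext fun i => congrArg x (Subsingleton.elim _ _), substF_id] at h₃
    simp only [app, liftF_substF, hu.imp, quote, liftT_numeral] at *
    tauto
  rw [inst, snoc_elim0, substF_imp, substF_eq, substT_x] at h₁
  simp only [quote, substT_numeral] at h₁
  refine Pv.of_valuation fun u hu => ?_
  have h₁ := hu.of_derives _ h₁
  have h₂ := hu.of_derives _ h₂
  have h₃ := hu.of_derives _ (Pv.eq_refl (quote θ : ATerm 0))
  simp only [hu.imp, hu.iff, app, quote] at *
  tauto

/-- The fixed point lemma, composed with a primitive recursive function on Gödel numbers. -/
theorem exists_fixed_point (φ : AFormula 1) {h : ℕ → ℕ} (hh : Nat.Primrec h) :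
    ∃ G : ASentence, Pv (G.iff (app φ (numeral (h (godelNum G))))) := by
  obtain ⟨d, hd, hdiag⟩ := exists_primrec_diag
  obtain ⟨D, hD⟩ := (Rep.of_primrec (hh.comp hd)).exists_formula
  -- `θ(x₀)` says that the value of `h ∘ d` at `x₀` satisfies `φ`. At `⌜θ⌝` that value is `h` of the
  -- Gödel number of `diag θ`.
  let θ : AFormula 1 := (D.imp (substF φ fun _ => x 1)).all
  refine ⟨diag θ, ?_⟩
  rw [← hdiag]
  have hθ : app θ (quote θ) = ((substF D (snoc (nums fun _ => godelNum θ) (x 0))).imp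
      (substF φ fun _ => x (Fin.last 0))).all := by
    simp only [app, θ, substF_all, substF_imp, substF_substF, quote, liftT_numeral]
    rfl
  have h₁ := Pv.all_imp (φ := (substF D (snoc (nums fun _ => godelNum θ) (x 0))).imp
      (substF φ fun _ => x (Fin.last 0))) (numeral (h (d (godelNum θ))))
  have h₂ : Pv ((app φ (numeral (h (d (godelNum θ))))).imp (app θ (quote θ))) := by
    rw [hθ]
    refine Pv.imp_all (Pv.of_valuation fun u hu => ?_)
    have h₃ := hu.of_derives _ (hD (fun _ => godelNum θ) 1 (x 0))
    have h₄ := hu.of_derives _ (eq_subst_app φ (numeral (h (d (godelNum θ)))) (x 0))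
    have h₅ := hu.of_derives _ (Pv.eq_symm (x 0 : ATerm 1) (numeral (h (d (godelNum θ)))))
    simp only [app, liftF_substF, hu.imp, hu.iff, liftT_numeral] at *
    exact fun hφ hd => h₄ (h₅ (h₃.1 hd)) hφ
  rw [← hθ, inst, substF_imp, substF_substF, substF_substF, substT_comp_snoc] at h₁
  simp only [substT_x, snoc_last, nums, substT_numeral] at h₁
  refine Pv.of_valuation fun u hu => ?_
  have h₁ := hu.of_derives _ h₁
  have h₂ := hu.of_derives _ h₂
  have h₃ := hu.of_derives _ (hD (fun _ => godelNum θ) 0 (numeral (h (d (godelNum θ)))))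
  have h₄ := hu.of_derives _ (Pv.eq_refl (numeral (h (d (godelNum θ))) : ATerm 0))
  have h₅ := hu.of_derives _ (pv_diag θ)
  simp only [hu.imp, hu.iff] at h₁ h₂ h₃ h₄ h₅ ⊢
  rw [h₅]
  exact ⟨fun ht => h₁ ht (h₃.2 h₄), h₂⟩

/-! ### Arithmetical interpretations -/

/-- The arithmetical interpretation that sends every propositional variable to `G`. -/
def interp (Pr : AFormula 1) (G : ASentence) : MF → ASentence
  | .var _ => G
  | .bot => eq (numeral 0) (numeral 1)
  | .neg A => (interp Pr G A).not
  | .and A B => interp Pr G A ⊓ interp Pr G B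
  | .or A B => interp Pr G A ⊔ interp Pr G B
  | .imp A B => (interp Pr G A).imp (interp Pr G B)
  | .box A => app Pr (quote (interp Pr G A))

theorem isInterpretation_interp (Pr : AFormula 1) (G : ASentence) :
    IsInterpretation Pr (interp Pr G) :=
  ⟨rfl, fun _ => rfl, fun _ _ => rfl, fun _ _ => rfl, fun _ _ => rfl, fun _ => rfl⟩

theorem interp_boxes (Pr : AFormula 1) (G : ASentence) (p n : ℕ) :
    interp Pr G (boxes n (.var p)) = (fun φ : ASentence => app Pr (quote φ))^[n] G := by
  induction n with
  | zero => rfl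
  | succ n ih => rw [Function.iterate_succ_apply', ← ih]; rfl

/-- There is a sentence that is equivalent to its own `n + 1`-fold unprovability. -/
theorem exists_not_iterate_app (Pr : AFormula 1) (n : ℕ) :
    ∃ G : ASentence,
      Pv (G.iff ((fun φ : ASentence => app Pr (quote φ))^[n + 1] G).not) := by
  have hp : ∀ n, Nat.Primrec (fun k => godelNum (app Pr (numeral k)))^[n] := by
    intro n
    induction n with
    | zero => exact Nat.Primrec.id
    | succ n ih => exact ih.comp (primrec_godelNum_app Pr)
  -- The outermost of the `n + 1` boxes comes from the formula `¬Pr`; the other `n` are applied by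
  -- the function on Gödel numbers.
  obtain ⟨G, hG⟩ := exists_fixed_point Pr.not (hp n)
  refine ⟨G, ?_⟩
  have e : godelNum ((fun φ : ASentence => app Pr (quote φ))^[n] G) =
      (fun k => godelNum (app Pr (numeral k)))^[n] (godelNum G) :=
    Function.Semiconj.iterate_right (f := fun φ : ASentence => godelNum φ)
      (ga := fun φ : ASentence => app Pr (quote φ))
      (gb := fun k => godelNum (app Pr (numeral k))) (fun _ => rfl) n G
  rw [Function.iterate_succ_apply', quote, e]
  exact hG

theorem boxes_imp_notMem_PL {T : Set ASentence} (hext : ∀ φ ∈ PA, Proves T φ)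
    (hcons : Consistent T) {Pr : AFormula 1} (hPr : IsProvabilityPredicate T Pr) (n p : ℕ) :
    (boxes (n + 1) (.var p)).imp (.var p) ∉ PL T Pr := by
  intro hmem
  obtain ⟨G, hG⟩ := exists_not_iterate_app Pr n
  have hT : ∀ {φ : ASentence}, Pv φ → Derives T φ := fun h => (pv_sentence.1 h).cut hext
  have h₁ : Derives T (interp Pr G _) := hmem _ (isInterpretation_interp Pr G)
  rw [interp, interp_boxes, interp] at h₁
  have h₂ := hT hG
  -- If `G` failed, the fixed point would give the iterated box, and reflection would give `G` back.
  have hTG : Derives T G := Derives.of_valuation fun v hv => by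
    have h₁ := hv.of_derives _ h₁
    have h₂ := hv.of_derives _ h₂
    simp only [hv.imp, hv.iff, hv.not] at h₁ h₂
    tauto
  have hbox : ∀ k, Derives T ((fun φ : ASentence => app Pr (quote φ))^[k] G) := by
    intro k
    induction k with
    | zero => exact hTG
    | succ k ih =>
      rw [Function.iterate_succ_apply']
      exact hT (pv_sentence.2 ((hPr 0 _).1 ih))
  refine hcons (Derives.of_valuation fun v hv => ?_)
  have h₁ := hv.of_derives _ hTG
  have h₂ := hv.of_derives _ h₂
  have h₃ := hv.of_derives _ (hbox (n + 1))
  simp only [hv.iff, hv.not] at h₂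
  tauto

end ProvLogic

/-- Let `T` be a primitive recursively axiomatized consistent extension of `PA`, and `n ≥ 1`. -/
theorem proposition3p4 (T : Set ProvLogic.ASentence) (hprim : ProvLogic.PrimrecAxioms T)
    (hext : ∀ φ ∈ ProvLogic.PA, ProvLogic.Proves T φ) (hcons : ProvLogic.Consistent T)
    (n : ℕ) (hn : 1 ≤ n) :
    (∀ p : ℕ, ¬ ∃ Pr : ProvLogic.AFormula 1, ProvLogic.IsProvabilityPredicate T Pr ∧
      (ProvLogic.boxes n (.var p)).imp (.var p) ∈ ProvLogic.PL T Pr) ∧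
    ¬ ∃ Pr : ProvLogic.AFormula 1, ProvLogic.IsProvabilityPredicate T Pr ∧
      ProvLogic.NA 0 n ⊆ ProvLogic.PL T Pr := by
  obtain ⟨n, rfl⟩ := Nat.exists_eq_add_of_le' hn
  refine ⟨?_, ?_⟩
  · rintro p ⟨Pr, hPr, h⟩
    exact ProvLogic.boxes_imp_notMem_PL hext hcons hPr n p h
  · rintro ⟨Pr, hPr, h⟩
    -- As `□^0 p` is `p`, the reflection formula is an instance of the axiom scheme.
    exact ProvLogic.boxes_imp_notMem_PL hext hcons hPr n 0 (h (ProvLogic.NA.acc (.var 0)))
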